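/- Let $\mathfrak H$ be a complex Hilbert space and let $(A,B)$ be a Pythagorean pair over $\mathfrak H$, i.e. $A,B\in B(\mathfrak H)$ with $A^*A+B^*B=\mathrm{id}_{\mathfrak H}$. A tree is a finite rooted binary tree (every vertex has no child or a left and a right child), with its leaves ordered from left to right; $f\circ t$ denotes the tree obtained from a tree $t$ with $n$ leaves by attaching the $i$-th tree of a forest $f=(f_1,\dots,f_n)$ at the $i$-th leaf of $t$. Thompson's group $F$ is the set of classes $[t,s]$ of pairs of trees with the same number of leaves, for the equivalence relation generated by $(t,s)\sim(f\circ t,f\circ s)$, with $[t,s]\,[t',s']=[f\circ t,f'\circ s']$ whenever $f\circ s=f'\circ t'$. For a tree $t$ with $n$ leaves let $\mathfrak H_t=\mathfrak H^{\oplus n}$ be the Hilbert space of decorations of the leaves of $t$ by vectors of $\mathfrak H$. If $t'$ is obtained from $t$ by adding a caret at the $k$-th leaf, let $\mathfrak H_t\to\mathfrak H_{t'}$ be the isometry $(\xi_1,\dots,\xi_n)\mapsto(\xi_1,\dots,\xi_{k-1},A\xi_k,B\xi_k,\xi_{k+1},\dots,\xi_n)$. Let $\mathscr K$ be the direct limit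 of the resulting directed system of the spaces $\mathfrak H_t$ over all trees $t$ (ordered by inclusion of rooted subtrees), $[t,\xi]\in\mathscr K$ the class of $\xi\in\mathfrak H_t$, and $\mathscr H$ the Hilbert space completion of $\mathscr K$. The Pythagorean representation $\sigma$ of $F$ associated to $(A,B)$ is the unitary representation of $F$ on $\mathscr H$ determined by $\sigma([t,s])[s,\xi]=[t,\xi]$ for all pairs $(t,s)$ of trees with the same number $n$ of leaves and all $\xi\in\mathfrak H^{\oplus n}$. If $\lim_{n\to\infty}A^n\xi=\lim_{n\to\infty}B^n\xi=0$ for every $\xi\in\mathfrak H$, then $\sigma$ is weakly mixing: there is no non-zero finite-dimensional closed linear subspace of $\mathscr H$ that is invariant under $\sigma(g)$ for all $g\in F$. -/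

import Mathlib

open Filter Topology

/-- Finite rooted binary trees in which every vertex has either no child (a leaf) or two
(left and right) children. -/
inductive BTree : Type
  | leaf : BTree
  | node : BTree → BTree → BTree

namespace BTree

/-- The number of leaves. The leaves are numbered `0, …, numLeaves t - 1` from left to right:
the leaves of `node l r` are those of `l` followed by those of `r`. -/
def numLeaves : BTree → ℕ
  | leaf => 1
  | node l r => numLeaves l + numLeaves r

/-- `t ≤ s` means that `t` is a rooted subtree of `s`. -/
protected def le : BTree → BTree → Prop
  | leaf, _ => True
  | node _ _, leaf => False
  | node l r, node l' r' => BTree.le l l' ∧ BTree.le r r'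

/-- The smallest tree containing two given trees as rooted subtrees. -/
protected def sup : BTree → BTree → BTree
  | leaf, s => s
  | node l r, leaf => node l r
  | node l r, node l' r' => node (BTree.sup l l') (BTree.sup r r')

instance : LE BTree := ⟨BTree.le⟩

theorem leaf_le (t : BTree) : leaf ≤ t := by
  show BTree.le leaf t
  simp [BTree.le]

theorem node_le_node {l r l' r' : BTree} : node l r ≤ node l' r' ↔ l ≤ l' ∧ r ≤ r' := by
  show BTree.le _ _ ↔ BTree.le _ _ ∧ BTree.le _ _
  simp [BTree.le]

theorem not_node_le_leaf {l r : BTree} : ¬ node l r ≤ leaf := by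
  show ¬ BTree.le _ _
  simp [BTree.le]

protected theorem le_refl' (t : BTree) : t ≤ t := by
  induction t with
  | leaf => exact leaf_le _
  | node l r hl hr => exact node_le_node.2 ⟨hl, hr⟩

protected theorem le_trans' {t s r : BTree} (h : t ≤ s) (h' : s ≤ r) : t ≤ r := by
  induction t generalizing s r with
  | leaf => exact leaf_le _
  | node a b ha hb =>
    cases s with
    | leaf => exact (not_node_le_leaf h).elim
    | node c d =>
      cases r with
      | leaf => exact (not_node_le_leaf h').elim
      | node e f =>
        rw [node_le_node] at *
        exact ⟨ha h.1 h'.1, hb h.2 h'.2⟩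

protected theorem le_antisymm' {t s : BTree} (h : t ≤ s) (h' : s ≤ t) : t = s := by
  induction t generalizing s with
  | leaf =>
    cases s with
    | leaf => rfl
    | node c d => exact (not_node_le_leaf h').elim
  | node a b ha hb =>
    cases s with
    | leaf => exact (not_node_le_leaf h).elim
    | node c d =>
      rw [node_le_node] at *
      rw [ha h.1 h'.1, hb h.2 h'.2]

protected theorem le_sup_left' (t s : BTree) : t ≤ BTree.sup t s := by
  induction t generalizing s with
  | leaf => exact leaf_le _
  | node a b ha hb =>
    cases s with
    | leaf => simpa [BTree.sup] using BTree.le_refl' _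
    | node c d => simpa [BTree.sup, node_le_node] using ⟨ha c, hb d⟩

protected theorem le_sup_right' (t s : BTree) : s ≤ BTree.sup t s := by
  induction t generalizing s with
  | leaf => simpa [BTree.sup] using BTree.le_refl' _
  | node a b ha hb =>
    cases s with
    | leaf => exact leaf_le _
    | node c d => simpa [BTree.sup, node_le_node] using ⟨ha c, hb d⟩

protected theorem sup_le' {t s r : BTree} (h : t ≤ r) (h' : s ≤ r) : BTree.sup t s ≤ r := by
  induction t generalizing s r with
  | leaf => simpa [BTree.sup] using h'
  | node a b ha hb =>
    cases s with
    | leaf => simpa [BTree.sup] using h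
    | node c d =>
      cases r with
      | leaf => exact (not_node_le_leaf h').elim
      | node e f =>
        simp only [BTree.sup, node_le_node] at *
        exact ⟨ha h.1 h'.1, hb h.2 h'.2⟩

instance : SemilatticeSup BTree where
  le_refl := BTree.le_refl'
  le_trans _ _ _ := BTree.le_trans'
  le_antisymm _ _ := BTree.le_antisymm'
  sup := BTree.sup
  le_sup_left := BTree.le_sup_left'
  le_sup_right := BTree.le_sup_right'
  sup_le _ _ _ := BTree.sup_le'

instance : Nonempty BTree := ⟨leaf⟩

/-- The composition `f ∘ t`: the `i`-th tree of the forest `f` is attached at the `i`-th leaf of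
`t`. A forest with `n` roots is represented by a sequence of trees of which only the first `n`
terms are used. -/
def graft : BTree → (ℕ → BTree) → BTree
  | leaf, f => f 0
  | node l r, f => node (graft l f) (graft r fun k => f (k + numLeaves l))

/-- For `t ≤ s`, the forest `f` with `s = f ∘ t` (junk otherwise). -/
def diff : BTree → BTree → ℕ → BTree
  | leaf, s => fun _ => s
  | node _ _, leaf => fun _ => leaf
  | node l r, node l' r' => fun k =>
      if k < numLeaves l then diff l l' k else diff r r' (k - numLeaves l)

theorem numLeaves_graft (t : BTree) (f : ℕ → BTree) :
    numLeaves (graft t f) = ∑ i ∈ Finset.range (numLeaves t), numLeaves (f i) := by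
  induction t generalizing f with
  | leaf => simp [graft, numLeaves]
  | node l r hl hr =>
    simp only [graft, numLeaves, hl, hr, Finset.sum_range_add]
    congr 1
    exact Finset.sum_congr rfl fun i _ => by rw [add_comm]

theorem graft_congr {t : BTree} {f g : ℕ → BTree} (h : ∀ i < numLeaves t, f i = g i) :
    graft t f = graft t g := by
  induction t generalizing f g with
  | leaf => exact h 0 (by simp [numLeaves])
  | node l r hl hr =>
    simp only [numLeaves] at h
    simp only [graft]
    rw [hl fun i hi => h i (by omega), hr fun i hi => h _ (by omega)]

theorem graft_injective {t : BTree} {f g : ℕ → BTree} (h : graft t f = graft t g) :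
    ∀ i < numLeaves t, f i = g i := by
  induction t generalizing f g with
  | leaf =>
    intro i hi
    simp only [numLeaves, Nat.lt_one_iff] at hi
    subst hi
    exact h
  | node l r hl hr =>
    simp only [graft, node.injEq] at h
    intro i hi
    simp only [numLeaves] at hi
    by_cases hil : i < numLeaves l
    · exact hl h.1 i hil
    · have := hr h.2 (i - numLeaves l) (by omega)
      simpa [Nat.sub_add_cancel (not_lt.1 hil)] using this

theorem graft_diff {t s : BTree} (h : t ≤ s) : graft t (diff t s) = s := by
  induction t generalizing s with
  | leaf => rfl
  | node l r hl hr =>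
    cases s with
    | leaf => exact (not_node_le_leaf h).elim
    | node l' r' =>
      rw [node_le_node] at h
      simp only [graft, node.injEq]
      constructor
      · conv_rhs => rw [← hl h.1]
        exact graft_congr fun i hi => by simp [diff, hi]
      · conv_rhs => rw [← hr h.2]
        exact graft_congr fun i hi => by simp [diff]

theorem le_graft (t : BTree) (f : ℕ → BTree) : t ≤ graft t f := by
  induction t generalizing f with
  | leaf => exact leaf_le _
  | node l r hl hr => exact node_le_node.2 ⟨hl _, hr _⟩

theorem graft_leaf (t : BTree) : graft t (fun _ => leaf) = t := by
  induction t with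
  | leaf => rfl
  | node l r hl hr => simp only [graft, hl, hr]

/-- The composition `g ∘ f` of two forests. -/
def forestComp (f g : ℕ → BTree) : ℕ → BTree := fun i =>
  graft (f i) fun k => g (k + ∑ j ∈ Finset.range i, numLeaves (f j))

theorem graft_graft (t : BTree) (f g : ℕ → BTree) :
    graft (graft t f) g = graft t (forestComp f g) := by
  induction t generalizing f g with
  | leaf => simp [graft, forestComp]
  | node l r hl hr =>
    simp only [graft, hl, hr, node.injEq, true_and]
    refine graft_congr fun i _ => ?_
    simp only [forestComp]
    refine graft_congr fun k _ => ?_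
    congr 1
    rw [numLeaves_graft, add_comm i, Finset.sum_range_add, add_assoc, add_comm (Finset.sum _ _)]
    simp only [add_comm]

theorem numLeaves_graft_eq {t s : BTree} (h : numLeaves t = numLeaves s) (f : ℕ → BTree) :
    numLeaves (graft t f) = numLeaves (graft s f) := by
  rw [numLeaves_graft, numLeaves_graft, h]

end BTree

/-- A tree-diagram: an ordered pair of trees with the same number of leaves. -/
structure TreeDiagram where
  /-- the first tree of the pair -/
  fst : BTree
  /-- the second tree of the pair -/
  snd : BTree
  numLeaves_eq : fst.numLeaves = snd.numLeaves

namespace TreeDiagram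

open BTree

/-- The tree-diagram `(f ∘ t, f ∘ s)` obtained from `(t, s)` and a forest `f`. -/
def expand (d : TreeDiagram) (f : ℕ → BTree) : TreeDiagram :=
  ⟨graft d.fst f, graft d.snd f, numLeaves_graft_eq d.numLeaves_eq f⟩

/-- The product of `(t, s)` and `(t', s')` on representatives: `(f ∘ t, f' ∘ s')`, where `f` and
`f'` are the forests with `f ∘ s = f' ∘ t' = s ⊔ t'`. -/
def mul (d d' : TreeDiagram) : TreeDiagram :=
  ⟨graft d.fst (diff d.snd (d.snd ⊔ d'.fst)), graft d'.snd (diff d'.fst (d.snd ⊔ d'.fst)), by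
    rw [numLeaves_graft_eq d.numLeaves_eq, ← numLeaves_graft_eq d'.numLeaves_eq,
      graft_diff le_sup_left, graft_diff le_sup_right]⟩

/-- The tree-diagram `(s, t)`. -/
def inv (d : TreeDiagram) : TreeDiagram := ⟨d.snd, d.fst, d.numLeaves_eq.symm⟩

end TreeDiagram

/-- Thompson's group `F`: the quotient of the set of tree-diagrams by the equivalence relation
generated by `(t, s) ∼ (f ∘ t, f ∘ s)`, for `f` a forest with as many roots as `t` has leaves. -/
def ThompsonF : Type := Quot fun d d' : TreeDiagram => ∃ f, d' = d.expand f

namespace ThompsonF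

open BTree

/-- The class `[t, s]` of the tree-diagram `(t, s)`. -/
def mk (d : TreeDiagram) : ThompsonF := Quot.mk _ d

theorem mk_expand (d : TreeDiagram) (f : ℕ → BTree) : mk (d.expand f) = mk d :=
  (Quot.sound ⟨f, rfl⟩).symm

theorem mk_graft {t s : BTree} (h : t.numLeaves = s.numLeaves) (f : ℕ → BTree) (h') :
    mk ⟨graft t f, graft s f, h'⟩ = mk ⟨t, s, h⟩ :=
  mk_expand ⟨t, s, h⟩ f

theorem graft_diff_of_le {t s v w : BTree} (hn : t.numLeaves = s.numLeaves) (hv : s ≤ v)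
    (hvw : v ≤ w) : graft t (diff s w) = graft (graft t (diff s v)) (diff v w) := by
  rw [graft_graft]
  refine graft_congr fun i hi => ?_
  refine graft_injective (t := s) ?_ i (hn ▸ hi)
  rw [← graft_graft, graft_diff hv, graft_diff hvw, graft_diff (hv.trans hvw)]

/-- The product of two classes may be computed on any common expansion of the two middle trees. -/
theorem mk_mul_eq (d d' : TreeDiagram) (f f' : ℕ → BTree)
    (h : graft d.snd f = graft d'.fst f') (h') :
    mk ⟨graft d.fst f, graft d'.snd f', h'⟩ = mk (d.mul d') := by
  have hw : d.snd ⊔ d'.fst ≤ graft d.snd f :=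
    sup_le (le_graft _ _) (h ▸ le_graft _ _)
  have h1 : graft d.fst f =
      graft (d.mul d').fst (diff (d.snd ⊔ d'.fst) (graft d.snd f)) := by
    rw [TreeDiagram.mul, ← graft_diff_of_le d.numLeaves_eq le_sup_left hw]
    refine graft_congr fun i hi => ?_
    exact graft_injective (graft_diff (le_graft _ _)).symm i (d.numLeaves_eq ▸ hi)
  have h2 : graft d'.snd f' =
      graft (d.mul d').snd (diff (d.snd ⊔ d'.fst) (graft d.snd f)) := by
    rw [TreeDiagram.mul, ← graft_diff_of_le d'.numLeaves_eq.symm le_sup_right hw, h]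
    refine graft_congr fun i hi => ?_
    exact graft_injective (graft_diff (le_graft _ _)).symm i (d'.numLeaves_eq.symm ▸ hi)
  rw [← mk_expand (d.mul d') (diff (d.snd ⊔ d'.fst) (graft d.snd f))]
  congr 1
  simp only [TreeDiagram.expand, TreeDiagram.mk.injEq]
  exact ⟨h1, h2⟩

theorem mk_mul_expand_right (d d' : TreeDiagram) (g : ℕ → BTree) :
    mk (d.mul (d'.expand g)) = mk (d.mul d') := by
  have hd : (d.mul (d'.expand g)) = ⟨graft d.fst (diff d.snd (d.snd ⊔ graft d'.fst g)),
      graft d'.snd (forestComp g (diff (graft d'.fst g) (d.snd ⊔ graft d'.fst g))), by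
        have := (d.mul (d'.expand g)).numLeaves_eq
        rwa [← graft_graft]⟩ := by
    simp only [TreeDiagram.mul, TreeDiagram.expand, graft_graft]
  rw [hd]
  apply mk_mul_eq
  rw [← graft_graft, graft_diff le_sup_left, graft_diff le_sup_right]

theorem mk_mul_expand_left (d d' : TreeDiagram) (g : ℕ → BTree) :
    mk ((d.expand g).mul d') = mk (d.mul d') := by
  have hd : ((d.expand g).mul d') =
      ⟨graft d.fst (forestComp g (diff (graft d.snd g) (graft d.snd g ⊔ d'.fst))),
        graft d'.snd (diff d'.fst (graft d.snd g ⊔ d'.fst)), by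
        have := ((d.expand g).mul d').numLeaves_eq
        rwa [← graft_graft]⟩ := by
    simp only [TreeDiagram.mul, TreeDiagram.expand, graft_graft]
  rw [hd]
  apply mk_mul_eq
  rw [← graft_graft, graft_diff le_sup_left, graft_diff le_sup_right]

instance : Mul ThompsonF where
  mul := Quot.lift₂ (fun d d' => mk (d.mul d'))
    (by rintro d d' _ ⟨f, rfl⟩; exact (mk_mul_expand_right d d' f).symm)
    (by rintro d d' e ⟨f, rfl⟩; exact (mk_mul_expand_left d e f).symm)

instance : One ThompsonF where
  one := mk ⟨leaf, leaf, rfl⟩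

instance : Inv ThompsonF where
  inv := Quot.lift (fun d => mk d.inv)
    (by rintro d _ ⟨f, rfl⟩; exact (mk_expand d.inv f).symm)

theorem mk_mul_mk (t s r : BTree) (h : t.numLeaves = s.numLeaves)
    (h' : s.numLeaves = r.numLeaves) :
    mk ⟨t, s, h⟩ * mk ⟨s, r, h'⟩ = mk ⟨t, r, h.trans h'⟩ := by
  have := mk_mul_eq ⟨t, s, h⟩ ⟨s, r, h'⟩ (fun _ => leaf) (fun _ => leaf) rfl
    (by simpa only [graft_leaf] using h.trans h')
  simp only [graft_leaf] at this
  exact this.symm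

theorem mk_self (t : BTree) : mk ⟨t, t, rfl⟩ = 1 :=
  mk_graft (t := leaf) (s := leaf) rfl (fun _ => t) rfl

theorem exists_snd_eq (x : ThompsonF) (v : BTree) :
    ∃ w, v ≤ w ∧ ∀ w', w ≤ w' → ∃ t h, x = mk ⟨t, w', h⟩ := by
  obtain ⟨⟨t, s, h⟩, rfl⟩ := Quot.exists_rep x
  refine ⟨s ⊔ v, le_sup_right, fun w' hw => ⟨graft t (diff s w'), ?_, ?_⟩⟩
  · rw [numLeaves_graft_eq h, graft_diff (le_sup_left.trans hw)]
  · have hs : graft s (diff s w') = w' := graft_diff (le_sup_left.trans hw)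
    have := mk_graft h (diff s w') (numLeaves_graft_eq h _)
    simp only [hs] at this
    exact this.symm

theorem inv_mk (d : TreeDiagram) : (mk d)⁻¹ = mk d.inv := rfl

theorem exists_fst_eq (x : ThompsonF) (v : BTree) :
    ∃ w, v ≤ w ∧ ∀ w', w ≤ w' → ∃ s h, x = mk ⟨w', s, h⟩ := by
  obtain ⟨d, rfl⟩ := Quot.exists_rep x
  obtain ⟨w, hw, H⟩ := exists_snd_eq (mk d.inv) v
  refine ⟨w, hw, fun w' h => ?_⟩
  obtain ⟨t, h1, h2⟩ := H w' h
  exact ⟨t, h1.symm, (inv_mk d.inv).symm.trans (by rw [h2]; rfl)⟩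

instance : Group ThompsonF where
  mul_assoc x y z := by
    obtain ⟨⟨b, c, hbc⟩, rfl⟩ := Quot.exists_rep y
    change x * mk _ * z = x * (mk _ * z)
    obtain ⟨w, hw, Hx⟩ := exists_snd_eq x b
    obtain ⟨w₂, hw₂, Hz⟩ := exists_fst_eq z (graft c (diff b w))
    obtain ⟨s, hs, rfl⟩ := Hz w₂ le_rfl
    have h1 : mk ⟨b, c, hbc⟩ = mk ⟨graft w (diff (graft c (diff b w)) w₂), w₂, by
        have := numLeaves_graft_eq hbc (diff b w)
        rw [graft_diff hw] at this
        rw [numLeaves_graft_eq this, graft_diff hw₂]⟩ := by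
      have h2 := mk_graft hbc (diff b w) (numLeaves_graft_eq hbc _)
      simp only [graft_diff hw] at h2
      have hn := numLeaves_graft_eq hbc (diff b w)
      rw [graft_diff hw] at hn
      have h3 := mk_graft hn (diff (graft c (diff b w)) w₂) (numLeaves_graft_eq hn _)
      simp only [graft_diff hw₂] at h3
      rw [h3, h2]
    obtain ⟨t, ht, rfl⟩ := Hx (graft w (diff (graft c (diff b w)) w₂)) (le_graft _ _)
    rw [h1]
    simp only [mk_mul_mk]
  one_mul x := by
    obtain ⟨⟨t, s, h⟩, rfl⟩ := Quot.exists_rep x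
    rw [← mk_self t]
    exact mk_mul_mk t t s rfl h
  mul_one x := by
    obtain ⟨⟨t, s, h⟩, rfl⟩ := Quot.exists_rep x
    rw [← mk_self s]
    exact mk_mul_mk t s s h rfl
  inv_mul_cancel x := by
    obtain ⟨⟨t, s, h⟩, rfl⟩ := Quot.exists_rep x
    change mk ⟨s, t, h.symm⟩ * mk ⟨t, s, h⟩ = 1
    rw [mk_mul_mk, mk_self]

end ThompsonF

namespace BTree

/-- The restriction to the leaves of `l` of a family indexed by the leaves of `node l r`. -/
def leftPart {α : Type*} {l r : BTree} (ξ : Fin (node l r).numLeaves → α) :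
    Fin l.numLeaves → α :=
  fun i => ξ (Fin.castAdd r.numLeaves i)

/-- The restriction to the leaves of `r` of a family indexed by the leaves of `node l r`. -/
def rightPart {α : Type*} {l r : BTree} (ξ : Fin (node l r).numLeaves → α) :
    Fin r.numLeaves → α :=
  fun i => ξ (Fin.natAdd l.numLeaves i)

/-- The family indexed by the leaves of `node l r` with the given restrictions. -/
def glue {α : Type*} {l r : BTree} (a : Fin l.numLeaves → α) (b : Fin r.numLeaves → α) :
    Fin (node l r).numLeaves → α :=
  Fin.append a b

section

variable {α : Type*} {l r : BTree}

theorem leftPart_glue (a : Fin l.numLeaves → α) (b : Fin r.numLeaves → α) :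
    leftPart (glue a b) = a := by
  funext i
  exact Fin.append_left _ _ i

theorem rightPart_glue (a : Fin l.numLeaves → α) (b : Fin r.numLeaves → α) :
    rightPart (glue a b) = b := by
  funext i
  exact Fin.append_right _ _ i

theorem glue_parts (ξ : Fin (node l r).numLeaves → α) : glue (leftPart ξ) (rightPart ξ) = ξ := by
  funext i
  refine Fin.addCases (m := l.numLeaves) (n := r.numLeaves) (fun i => ?_) (fun i => ?_) i
  · exact Fin.append_left _ _ i
  · exact Fin.append_right _ _ i

theorem glue_ext {ξ η : Fin (node l r).numLeaves → α} (h : leftPart ξ = leftPart η)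
    (h' : rightPart ξ = rightPart η) : ξ = η := by
  rw [← glue_parts ξ, h, h', glue_parts]

theorem ofFn_node (ξ : Fin (node l r).numLeaves → α) :
    List.ofFn ξ = List.ofFn (leftPart ξ) ++ List.ofFn (rightPart ξ) := by
  conv_lhs => rw [← glue_parts ξ]
  exact List.ofFn_fin_append _ _

theorem sum_node [AddCommMonoid α] (ξ : Fin (node l r).numLeaves → α) :
    ∑ i, ξ i = ∑ i, leftPart ξ i + ∑ i, rightPart ξ i :=
  Fin.sum_univ_add (a := l.numLeaves) (b := r.numLeaves) ξ

end

end BTree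

/-- A Pythagorean pair over a Hilbert space `𝔥`: bounded operators `A`, `B` with
`A* A + B* B = 1`. -/
structure PythagoreanPair (𝔥 : Type*) [NormedAddCommGroup 𝔥] [InnerProductSpace ℂ 𝔥]
    [CompleteSpace 𝔥] where
  /-- the first operator -/
  A : 𝔥 →L[ℂ] 𝔥
  /-- the second operator -/
  B : 𝔥 →L[ℂ] 𝔥
  pythagoras : star A * A + star B * B = 1

namespace PythagoreanPair

attribute [-instance] WithCStarModule.instCStarModuleComplex

open BTree
open scoped InnerProductSpace

variable {𝔥 : Type*} [NormedAddCommGroup 𝔥] [InnerProductSpace ℂ 𝔥] [CompleteSpace 𝔥]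

theorem inner_add_inner (P : PythagoreanPair 𝔥) (x y : 𝔥) :
    ⟪P.A x, P.A y⟫_ℂ + ⟪P.B x, P.B y⟫_ℂ = ⟪x, y⟫_ℂ := by
  have h := congrArg (fun T : 𝔥 →L[ℂ] 𝔥 => ⟪x, T y⟫_ℂ) P.pythagoras
  simpa [inner_add_right, ContinuousLinearMap.star_eq_adjoint,
    ContinuousLinearMap.adjoint_inner_right] using h

/-- The decoration of the leaves of the tree `t` obtained from the trivial tree decorated by `x`
by growing `t`: each new caret below a vertex decorated by `y` has its left and right leaves
decorated by `A y` and `B y`. -/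
def row (P : PythagoreanPair 𝔥) : (t : BTree) → 𝔥 → Fin t.numLeaves → 𝔥
  | leaf, x => fun _ => x
  | node l r, x => glue (P.row l (P.A x)) (P.row r (P.B x))

/-- For `t ≤ s = f ∘ t`, the map `Φ(f)` from decorations of `t` to decorations of `s`: below the
`i`-th leaf of `t`, which is decorated by `ξ i`, the `i`-th tree of `f` is grown
(junk if `t ≤ s` fails). -/
def grow (P : PythagoreanPair 𝔥) :
    (t s : BTree) → (Fin t.numLeaves → 𝔥) → Fin s.numLeaves → 𝔥
  | leaf, s, ξ => P.row s (ξ ⟨0, Nat.one_pos⟩)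
  | node _ _, leaf, _ => 0
  | node l r, node l' r', ξ => glue (P.grow l l' (leftPart ξ)) (P.grow r r' (rightPart ξ))

theorem row_add (P : PythagoreanPair 𝔥) (t : BTree) (x y : 𝔥) :
    P.row t (x + y) = P.row t x + P.row t y := by
  induction t generalizing x y with
  | leaf => rfl
  | node l r hl hr =>
    apply glue_ext
    · simp only [row, map_add, leftPart_glue, hl]
      conv_lhs => rw [← leftPart_glue (P.row l (P.A x)) (P.row r (P.B x)),
        ← leftPart_glue (P.row l (P.A y)) (P.row r (P.B y))]
      rfl
    · simp only [row, map_add, rightPart_glue, hr]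
      conv_lhs => rw [← rightPart_glue (P.row l (P.A x)) (P.row r (P.B x)),
        ← rightPart_glue (P.row l (P.A y)) (P.row r (P.B y))]
      rfl

theorem row_smul (P : PythagoreanPair 𝔥) (t : BTree) (c : ℂ) (x : 𝔥) :
    P.row t (c • x) = c • P.row t x := by
  induction t generalizing x with
  | leaf => rfl
  | node l r hl hr =>
    apply glue_ext
    · simp only [row, map_smul, leftPart_glue, hl]
      conv_lhs => rw [← leftPart_glue (P.row l (P.A x)) (P.row r (P.B x))]
      rfl
    · simp only [row, map_smul, rightPart_glue, hr]
      conv_lhs => rw [← rightPart_glue (P.row l (P.A x)) (P.row r (P.B x))]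
      rfl

theorem leftPart_grow (P : PythagoreanPair 𝔥) (l r l' r' : BTree)
    (ξ : Fin (node l r).numLeaves → 𝔥) :
    leftPart (P.grow (node l r) (node l' r') ξ) = P.grow l l' (leftPart ξ) :=
  leftPart_glue _ _

theorem rightPart_grow (P : PythagoreanPair 𝔥) (l r l' r' : BTree)
    (ξ : Fin (node l r).numLeaves → 𝔥) :
    rightPart (P.grow (node l r) (node l' r') ξ) = P.grow r r' (rightPart ξ) :=
  rightPart_glue _ _

theorem grow_add (P : PythagoreanPair 𝔥) (t s : BTree) (ξ η : Fin t.numLeaves → 𝔥) :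
    P.grow t s (ξ + η) = P.grow t s ξ + P.grow t s η := by
  induction t generalizing s with
  | leaf => simp only [grow, Pi.add_apply, row_add]
  | node l r hl hr =>
    cases s with
    | leaf => simp [grow]
    | node l' r' =>
      apply glue_ext
      · rw [leftPart_grow]
        refine (hl l' (leftPart ξ) (leftPart η)).trans ?_
        rw [← leftPart_grow P l r l' r' ξ, ← leftPart_grow P l r l' r' η]
        rfl
      · rw [rightPart_grow]
        refine (hr r' (rightPart ξ) (rightPart η)).trans ?_
        rw [← rightPart_grow P l r l' r' ξ, ← rightPart_grow P l r l' r' η]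
        rfl

theorem grow_smul (P : PythagoreanPair 𝔥) (t s : BTree) (c : ℂ) (ξ : Fin t.numLeaves → 𝔥) :
    P.grow t s (c • ξ) = c • P.grow t s ξ := by
  induction t generalizing s with
  | leaf => simp only [grow, Pi.smul_apply, row_smul]
  | node l r hl hr =>
    cases s with
    | leaf => simp [grow]
    | node l' r' =>
      apply glue_ext
      · rw [leftPart_grow]
        refine (hl l' (leftPart ξ)).trans ?_
        rw [← leftPart_grow P l r l' r' ξ]
        rfl
      · rw [rightPart_grow]
        refine (hr r' (rightPart ξ)).trans ?_
        rw [← rightPart_grow P l r l' r' ξ]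
        rfl

theorem sum_inner_node {E : Type*} [NormedAddCommGroup E] [InnerProductSpace ℂ E] {l r : BTree}
    (ξ η : Fin (node l r).numLeaves → E) :
    ∑ i, ⟪ξ i, η i⟫_ℂ =
      ∑ i, ⟪leftPart ξ i, leftPart η i⟫_ℂ + ∑ i, ⟪rightPart ξ i, rightPart η i⟫_ℂ :=
  sum_node fun i => ⟪ξ i, η i⟫_ℂ

theorem sum_inner_row (P : PythagoreanPair 𝔥) (t : BTree) (x y : 𝔥) :
    ∑ i, ⟪P.row t x i, P.row t y i⟫_ℂ = ⟪x, y⟫_ℂ := by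
  induction t generalizing x y with
  | leaf => exact Fin.sum_univ_one fun _ => ⟪x, y⟫_ℂ
  | node l r hl hr =>
    rw [← P.inner_add_inner, ← hl, ← hr, sum_inner_node]
    simp only [row, leftPart_glue, rightPart_glue]

theorem sum_inner_grow (P : PythagoreanPair 𝔥) {t s : BTree} (h : t ≤ s)
    (ξ η : Fin t.numLeaves → 𝔥) :
    ∑ i, ⟪P.grow t s ξ i, P.grow t s η i⟫_ℂ = ∑ i, ⟪ξ i, η i⟫_ℂ := by
  induction t generalizing s with
  | leaf =>
    simp only [grow, sum_inner_row]
    exact (Fin.sum_univ_one fun i : Fin 1 => ⟪ξ i, η i⟫_ℂ).symm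
  | node l r hl hr =>
    cases s with
    | leaf => exact (not_node_le_leaf h).elim
    | node l' r' =>
      rw [node_le_node] at h
      rw [sum_inner_node, sum_inner_node]
      simp only [leftPart_grow, rightPart_grow]
      rw [hl h.1, hr h.2]

theorem grow_self (P : PythagoreanPair 𝔥) (t : BTree) (ξ : Fin t.numLeaves → 𝔥) :
    P.grow t t ξ = ξ := by
  induction t with
  | leaf => exact funext fun i => congrArg ξ (Subsingleton.elim (α := Fin 1) _ _)
  | node l r hl hr => simp only [grow, hl, hr, glue_parts]

theorem grow_row (P : PythagoreanPair 𝔥) {t s : BTree} (h : t ≤ s) (x : 𝔥) :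
    P.grow t s (P.row t x) = P.row s x := by
  induction t generalizing s x with
  | leaf => rfl
  | node l r hl hr =>
    cases s with
    | leaf => exact (not_node_le_leaf h).elim
    | node l' r' =>
      rw [node_le_node] at h
      simp only [grow, row, leftPart_glue, rightPart_glue]
      rw [hl h.1, hr h.2]

theorem grow_grow (P : PythagoreanPair 𝔥) {t s r : BTree} (h : t ≤ s) (h' : s ≤ r)
    (ξ : Fin t.numLeaves → 𝔥) : P.grow s r (P.grow t s ξ) = P.grow t r ξ := by
  induction t generalizing s r with
  | leaf => exact P.grow_row h' _
  | node a b ha hb =>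
    cases s with
    | leaf => exact (not_node_le_leaf h).elim
    | node c d =>
      cases r with
      | leaf => exact (not_node_le_leaf h').elim
      | node e f =>
        rw [node_le_node] at h h'
        simp only [grow, leftPart_glue, rightPart_glue]
        rw [ha h.1 h'.1, hb h.2 h'.2]

/-- The decoration of `f ∘ t` obtained from `ξ` is the concatenation of the decorations of the
trees `f i` grown from `ξ i`. -/
theorem ofFn_grow_graft (P : PythagoreanPair 𝔥) (t : BTree) (f : ℕ → BTree)
    (ξ : Fin t.numLeaves → 𝔥) :
    List.ofFn (P.grow t (graft t f) ξ) =
      (List.ofFn fun i => List.ofFn (P.row (f i) (ξ i))).flatten := by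
  induction t generalizing f with
  | leaf =>
    have : (List.ofFn fun i : Fin 1 => List.ofFn (P.row (f i) (ξ i))).flatten =
        List.ofFn (P.row (f 0) (ξ ⟨0, Nat.one_pos⟩)) := by
      simp
      rfl
    exact this.symm
  | node l r hl hr =>
    have h1 : List.ofFn (P.grow (node l r) (graft (node l r) f) ξ) =
        List.ofFn (P.grow l (graft l f) (leftPart ξ)) ++
        List.ofFn (P.grow r (graft r fun k => f (k + numLeaves l)) (rightPart ξ)) := by
      rw [graft, ofFn_node, leftPart_grow, rightPart_grow]
    rw [h1, hl, hr, ofFn_node (fun i => List.ofFn (P.row (f i) (ξ i))), List.flatten_append]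
    congr 3
    funext i
    exact congrArg (fun k => List.ofFn (P.row (f k) (rightPart ξ i))) (add_comm _ _)

theorem grow_graft_cast (P : PythagoreanPair 𝔥) {t s : BTree} (h : t.numLeaves = s.numLeaves)
    (f : ℕ → BTree) (ξ : Fin s.numLeaves → 𝔥) :
    P.grow t (graft t f) (fun i => ξ (Fin.cast h i)) =
      fun i => P.grow s (graft s f) ξ (Fin.cast (numLeaves_graft_eq h f) i) := by
  apply List.ofFn_injective
  rw [← List.ofFn_congr (numLeaves_graft_eq h f).symm, ofFn_grow_graft, ofFn_grow_graft]
  congr 1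
  exact (List.ofFn_congr h.symm fun i => List.ofFn (P.row (f i) (ξ i))).symm ▸ rfl

/-- The Hilbert space `𝔥_t = ℓ²(Leaf(t), 𝔥)` of decorations of the leaves of `t`. -/
abbrev TreeSpace (𝔥 : Type*) (t : BTree) : Type _ := PiLp 2 fun _ : Fin t.numLeaves => 𝔥

/-- The connecting isometry `ι_t^s : 𝔥_t → 𝔥_s` for `t ≤ s`. -/
noncomputable def connect (P : PythagoreanPair 𝔥) (t s : BTree) (h : t ≤ s) :
    TreeSpace 𝔥 t →ₗᵢ[ℂ] TreeSpace 𝔥 s :=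
  LinearMap.isometryOfInner
    { toFun := fun ξ => WithLp.toLp 2 (P.grow t s ξ.ofLp)
      map_add' := fun ξ η => by simp [grow_add]
      map_smul' := fun c ξ => by simp [grow_smul] }
    fun ξ η => by simpa [PiLp.inner_apply] using P.sum_inner_grow h ξ.ofLp η.ofLp

theorem ofLp_connect (P : PythagoreanPair 𝔥) {t s : BTree} (h : t ≤ s) (ξ : TreeSpace 𝔥 t) :
    (P.connect t s h ξ).ofLp = P.grow t s ξ.ofLp := rfl

theorem connect_connect (P : PythagoreanPair 𝔥) {t s r : BTree} (h : t ≤ s) (h' : s ≤ r)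
    (ξ : TreeSpace 𝔥 t) : P.connect s r h' (P.connect t s h ξ) = P.connect t r (h.trans h') ξ := by
  apply WithLp.ofLp_injective
  simp only [ofLp_connect, P.grow_grow h h']

instance (P : PythagoreanPair 𝔥) :
    DirectedSystem (TreeSpace 𝔥) (fun t s h => P.connect t s h) where
  map_self t ξ := WithLp.ofLp_injective 2 (by simp only [ofLp_connect, grow_self])
  map_map _ _ _ hij hjk ξ := P.connect_connect hij hjk ξ

/-- The direct limit `𝓚` of the directed system of the spaces `𝔥_t` over all trees `t`. -/
def PreSpace (P : PythagoreanPair 𝔥) : Type _ := DirectLimit (TreeSpace 𝔥) P.connect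

namespace PreSpace

variable {P : PythagoreanPair 𝔥}

noncomputable instance : AddCommGroup P.PreSpace :=
  inferInstanceAs (AddCommGroup (DirectLimit (TreeSpace 𝔥) P.connect))

noncomputable instance : Module ℂ P.PreSpace :=
  inferInstanceAs (Module ℂ (DirectLimit (TreeSpace 𝔥) P.connect))

/-- The class `[t, ξ]` of a decorated tree. -/
noncomputable def mk (P : PythagoreanPair 𝔥) (t : BTree) (ξ : TreeSpace 𝔥 t) : P.PreSpace :=
  Quotient.mk (DirectLimit.setoid P.connect) ⟨t, ξ⟩

theorem mk_connect {t s : BTree} (h : t ≤ s) (ξ : TreeSpace 𝔥 t) :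
    mk P s (P.connect t s h ξ) = mk P t ξ :=
  (DirectLimit.mk_apply t s ξ h)

theorem ind {C : P.PreSpace → Prop} (h : ∀ t ξ, C (mk P t ξ)) (x) : C x :=
  DirectLimit.induction _ h x

theorem exists_mk (x : P.PreSpace) (v : BTree) :
    ∃ t ξ, v ≤ t ∧ x = mk P t ξ := by
  induction x using ind with
  | h t ξ => exact ⟨t ⊔ v, P.connect t _ le_sup_left ξ, le_sup_right, (mk_connect _ _).symm⟩

theorem ind₂ {C : P.PreSpace → P.PreSpace → Prop} (h : ∀ t ξ η, C (mk P t ξ) (mk P t η)) (x y) :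
    C x y :=
  DirectLimit.induction₂ _ h x y

theorem ind₃ {C : P.PreSpace → P.PreSpace → P.PreSpace → Prop}
    (h : ∀ t ξ η ζ, C (mk P t ξ) (mk P t η) (mk P t ζ)) (x y z) : C x y z :=
  DirectLimit.induction₃ _ h x y z

theorem mk_add (t : BTree) (ξ η : TreeSpace 𝔥 t) : mk P t (ξ + η) = mk P t ξ + mk P t η :=
  (DirectLimit.add_def (f := P.connect) t ξ η).symm

theorem mk_smul (t : BTree) (c : ℂ) (ξ : TreeSpace 𝔥 t) : mk P t (c • ξ) = c • mk P t ξ :=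
  (DirectLimit.smul_def (f := P.connect) t ξ c).symm

theorem mk_zero (t : BTree) : mk P t 0 = 0 :=
  (DirectLimit.zero_def (f := P.connect) t).symm

/-- The inner product on `𝓚` for which all the maps `ξ ↦ [t, ξ]` are isometric. -/
@[reducible]
noncomputable def core (P : PythagoreanPair 𝔥) : InnerProductSpace.Core ℂ P.PreSpace where
  inner := DirectLimit.lift₂ P.connect P.connect (fun _ ξ η => ⟪ξ, η⟫_ℂ)
    fun _ _ _ _ _ => ((P.connect _ _ _).inner_map_map _ _).symm
  conj_inner_symm := ind₂ fun t ξ η => by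
    simp only [mk, DirectLimit.lift₂_def]
    exact inner_conj_symm _ _
  re_inner_nonneg := ind fun t ξ => by
    simp only [mk, DirectLimit.lift₂_def]
    exact inner_self_nonneg
  add_left := ind₃ fun t ξ η ζ => by
    rw [← mk_add]
    simp only [mk, DirectLimit.lift₂_def]
    exact inner_add_left _ _ _
  smul_left x y c := by
    induction x, y using ind₂ with
    | h t ξ η =>
    rw [← mk_smul]
    simp only [mk, DirectLimit.lift₂_def]
    exact inner_smul_left _ _ _
  definite := ind fun t ξ => by
    intro h
    simp only [mk, DirectLimit.lift₂_def] at h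
    rw [inner_self_eq_zero.1 h]
    exact mk_zero t

noncomputable instance : NormedAddCommGroup P.PreSpace :=
  (core P).toNormedAddCommGroup

noncomputable instance : InnerProductSpace ℂ P.PreSpace :=
  InnerProductSpace.ofCore (core P).toCore

theorem inner_mk_mk (t : BTree) (ξ η : TreeSpace 𝔥 t) :
    ⟪mk P t ξ, mk P t η⟫_ℂ = ⟪ξ, η⟫_ℂ :=
  DirectLimit.lift₂_def (f₁ := P.connect) (f₂ := P.connect) (fun _ ξ η => ⟪ξ, η⟫_ℂ)
    (fun _ _ _ _ _ => ((P.connect _ _ _).inner_map_map _ _).symm) t ξ η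

/-- A decoration of the leaves of `s`, seen as a decoration of the leaves of a tree `t` with the
same number of leaves (the `i`-th leaf of `t` receives the decoration of the `i`-th leaf
of `s`). -/
def relabel {E : Type*} {t s : BTree} (h : t.numLeaves = s.numLeaves) (ξ : TreeSpace E s) :
    TreeSpace E t :=
  WithLp.toLp 2 fun i => ξ (Fin.cast h i)

theorem connect_relabel {t s : BTree} (h : t.numLeaves = s.numLeaves) (f : ℕ → BTree)
    (ξ : TreeSpace 𝔥 s) :
    P.connect t (graft t f) (le_graft t f) (relabel h ξ) =
      relabel (numLeaves_graft_eq h f) (P.connect s (graft s f) (le_graft s f) ξ) :=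
  WithLp.ofLp_injective 2 (P.grow_graft_cast h f ξ.ofLp)

theorem mk_relabel_congr {t t' s : BTree} (e : t = t') (h : t.numLeaves = s.numLeaves)
    (h' : t'.numLeaves = s.numLeaves) (ξ : TreeSpace 𝔥 s) :
    mk P t (relabel h ξ) = mk P t' (relabel h' ξ) := by
  subst e
  rfl

theorem mk_relabel_connect {t s w : BTree} (h : t.numLeaves = s.numLeaves) (hw : s ≤ w)
    (h' : (graft t (diff s w)).numLeaves = w.numLeaves) (ξ : TreeSpace 𝔥 s) :
    mk P (graft t (diff s w)) (relabel h' (P.connect s w hw ξ)) = mk P t (relabel h ξ) := by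
  obtain ⟨f, rfl⟩ : ∃ f, w = graft s f := ⟨_, (graft_diff hw).symm⟩
  have ht : graft t (diff s (graft s f)) = graft t f :=
    graft_congr fun i hi => graft_injective (graft_diff hw) i (h ▸ hi)
  revert h'
  rw [ht]
  intro h'
  rw [← connect_relabel h f, mk_connect]

theorem numLeaves_graft_diff (d : TreeDiagram) {w : BTree} (hw : d.snd ≤ w) :
    (graft d.fst (diff d.snd w)).numLeaves = w.numLeaves := by
  rw [numLeaves_graft_eq d.numLeaves_eq, graft_diff hw]

/-- The vector `[f ∘ t, Φ(h) ξ]`, where `w ≥ s, r` and `w = f ∘ s = h ∘ r`. -/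
noncomputable def actAux (P : PythagoreanPair 𝔥) (d : TreeDiagram) (r w : BTree) (hs : d.snd ≤ w) (hr : r ≤ w)
    (ξ : TreeSpace 𝔥 r) : P.PreSpace :=
  mk P (graft d.fst (diff d.snd w)) (relabel (numLeaves_graft_diff d hs) (P.connect r w hr ξ))

theorem actAux_of_le (d : TreeDiagram) (r w w' : BTree) (hs : d.snd ≤ w) (hr : r ≤ w)
    (hw : w ≤ w') (ξ : TreeSpace 𝔥 r) :
    actAux P d r w' (hs.trans hw) (hr.trans hw) ξ = actAux P d r w hs hr ξ := by
  have h1 := ThompsonF.graft_diff_of_le d.numLeaves_eq hs hw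
  have hn := numLeaves_graft_diff d (hs.trans hw)
  have h2 := mk_relabel_connect (P := P) (numLeaves_graft_diff d hs) hw (h1 ▸ hn)
    (P.connect r w hr ξ)
  rw [actAux, actAux, ← h2, connect_connect]
  exact mk_relabel_congr h1 _ _ _

theorem actAux_indep (d : TreeDiagram) (r w w' : BTree) (hs : d.snd ≤ w) (hr : r ≤ w)
    (hs' : d.snd ≤ w') (hr' : r ≤ w') (ξ : TreeSpace 𝔥 r) :
    actAux P d r w hs hr ξ = actAux P d r w' hs' hr' ξ := by
  rw [← actAux_of_le d r w (w ⊔ w') hs hr le_sup_left,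
    ← actAux_of_le d r w' (w ⊔ w') hs' hr' le_sup_right]

/-- The action of a tree-diagram `(t, s)` on `𝓚`: it maps `[r, ξ]` to `[f ∘ t, Φ(h) ξ]`, where
`w = s ⊔ r = f ∘ s = h ∘ r`. -/
noncomputable def act (P : PythagoreanPair 𝔥) (d : TreeDiagram) : P.PreSpace → P.PreSpace :=
  DirectLimit.lift P.connect
    (fun r ξ => actAux P d r (d.snd ⊔ r) le_sup_left le_sup_right ξ)
    fun r r' h ξ => by
      rw [actAux_indep d r (d.snd ⊔ r) (d.snd ⊔ r') le_sup_left le_sup_right le_sup_left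
        (h.trans le_sup_right), actAux, actAux, connect_connect]

theorem act_mk (d : TreeDiagram) (r w : BTree) (hs : d.snd ≤ w) (hr : r ≤ w)
    (ξ : TreeSpace 𝔥 r) : act P d (mk P r ξ) = actAux P d r w hs hr ξ :=
  actAux_indep d r (d.snd ⊔ r) w le_sup_left le_sup_right hs hr ξ

/-- The tree-diagram `(t, s)` maps `[s, ξ]` to `[t, ξ]`. -/
theorem act_mk_snd (d : TreeDiagram) (ξ : TreeSpace 𝔥 d.snd) :
    act P d (mk P d.snd ξ) = mk P d.fst (relabel d.numLeaves_eq ξ) := by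
  rw [act_mk d d.snd d.snd le_rfl le_rfl, actAux, mk_relabel_connect]

theorem act_expand (d : TreeDiagram) (f : ℕ → BTree) : act P (d.expand f) = act P d := by
  funext x
  obtain ⟨r, ξ, hr, rfl⟩ := exists_mk x (d.expand f).snd
  have hs : d.snd ≤ r := (le_graft _ _).trans hr
  rw [act_mk _ r r hr le_rfl, act_mk _ r r hs le_rfl]
  have h : graft (d.expand f).fst (diff (d.expand f).snd r) = graft d.fst (diff d.snd r) := by
    rw [ThompsonF.graft_diff_of_le d.numLeaves_eq (le_graft d.snd f) hr]
    congr 1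
    exact graft_congr fun i hi =>
      (graft_injective (graft_diff (le_graft _ _)) i (d.numLeaves_eq ▸ hi)).symm
  exact mk_relabel_congr h _ _ _

/-- The action of Thompson's group `F` on `𝓚`. -/
noncomputable def smulF (P : PythagoreanPair 𝔥) (g : ThompsonF) : P.PreSpace → P.PreSpace :=
  Quot.lift (fun d => act P d) (by rintro d _ ⟨f, rfl⟩; exact (act_expand d f).symm) g

theorem smulF_mk (t s : BTree) (h : t.numLeaves = s.numLeaves) (ξ : TreeSpace 𝔥 s) :
    smulF P (ThompsonF.mk ⟨t, s, h⟩) (mk P s ξ) = mk P t (relabel h ξ) :=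
  act_mk_snd ⟨t, s, h⟩ ξ

theorem inner_relabel {E : Type*} [NormedAddCommGroup E] [InnerProductSpace ℂ E] {t s : BTree} (h : t.numLeaves = s.numLeaves) (ξ η : TreeSpace E s) :
    ⟪relabel h ξ, relabel h η⟫_ℂ = ⟪ξ, η⟫_ℂ := by
  simp only [PiLp.inner_apply, relabel]
  exact (finCongr h).sum_comp fun i => ⟪ξ i, η i⟫_ℂ

theorem exists_common (g : ThompsonF) (v : BTree) :
    ∃ w, v ≤ w ∧ ∃ t h, g = ThompsonF.mk ⟨t, w, h⟩ := by
  obtain ⟨w, hw, H⟩ := ThompsonF.exists_snd_eq g v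
  exact ⟨w, hw, H w le_rfl⟩

/-- The action of `g ∈ F` on `𝓚`, as a linear isometry. -/
noncomputable def actIsometry (P : PythagoreanPair 𝔥) (g : ThompsonF) : P.PreSpace →ₗᵢ[ℂ] P.PreSpace :=
  LinearMap.isometryOfInner
    { toFun := smulF P g
      map_add' := fun x y => by
        induction x, y using ind₂ with
        | h r ξ η =>
        obtain ⟨w, hw, t, h, rfl⟩ := exists_common g r
        rw [← mk_connect hw ξ, ← mk_connect hw η, ← mk_add, smulF_mk, smulF_mk, smulF_mk,
          ← mk_add]
        rfl
      map_smul' := fun c x => by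
        induction x using ind with
        | h r ξ =>
        obtain ⟨w, hw, t, h, rfl⟩ := exists_common g r
        rw [← mk_connect hw ξ, ← mk_smul, smulF_mk, smulF_mk, RingHom.id_apply, ← mk_smul]
        rfl }
    fun x y => by
      change ⟪smulF P g x, smulF P g y⟫_ℂ = _
      induction x, y using ind₂ with
      | h r ξ η =>
      obtain ⟨w, hw, t, h, rfl⟩ := exists_common g r
      rw [← mk_connect hw ξ, ← mk_connect hw η, smulF_mk, smulF_mk, inner_mk_mk, inner_mk_mk,
        inner_relabel]

theorem actIsometry_apply (g : ThompsonF) (x : P.PreSpace) :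
    actIsometry P g x = smulF P g x := rfl

theorem actIsometry_one : actIsometry P 1 = 1 := by
  ext x
  induction x using ind with
  | h r ξ =>
  rw [← ThompsonF.mk_self r]
  exact smulF_mk (P := P) r r rfl ξ

theorem actIsometry_mul (g g' : ThompsonF) :
    actIsometry P (g * g') = actIsometry P g * actIsometry P g' := by
  ext x
  change smulF P (g * g') x = smulF P g (smulF P g' x)
  obtain ⟨⟨t', s', h'⟩, rfl⟩ := Quot.exists_rep g'
  obtain ⟨r, ξ, hr, rfl⟩ := exists_mk x s'
  have hn : (graft t' (diff s' r)).numLeaves = r.numLeaves := by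
    rw [numLeaves_graft_eq h', graft_diff hr]
  obtain ⟨w, hw, t, h, rfl⟩ := exists_common g (graft t' (diff s' r))
  have hn' : w.numLeaves = (graft r (diff (graft t' (diff s' r)) w)).numLeaves := by
    rw [← numLeaves_graft_eq hn, graft_diff hw]
  have hg' : (Quot.mk _ ⟨t', s', h'⟩ : ThompsonF) =
      ThompsonF.mk ⟨w, graft r (diff (graft t' (diff s' r)) w), hn'⟩ := by
    have h2 := ThompsonF.mk_graft h' (diff s' r) (numLeaves_graft_eq h' _)
    simp only [graft_diff hr] at h2
    have h3 := ThompsonF.mk_graft hn (diff (graft t' (diff s' r)) w) (numLeaves_graft_eq hn _)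
    simp only [graft_diff hw] at h3
    rw [h3, h2]
    rfl
  rw [hg', ThompsonF.mk_mul_mk, ← mk_connect (le_graft r (diff (graft t' (diff s' r)) w)) ξ,
    smulF_mk, smulF_mk, smulF_mk]
  rfl

end PreSpace

/-- The Hilbert space `𝓗`: the completion of the pre-Hilbert space `𝓚`. -/
abbrev Space (P : PythagoreanPair 𝔥) : Type _ := UniformSpace.Completion P.PreSpace

/-- The extension to `𝓗` of the action of `g ∈ F` on `𝓚`. -/
noncomputable def jonesOp (P : PythagoreanPair 𝔥) (g : ThompsonF) : P.Space →L[ℂ] P.Space :=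
  (PreSpace.actIsometry P g).toContinuousLinearMap.completion

theorem jonesOp_coe (P : PythagoreanPair 𝔥) (g : ThompsonF) (x : P.PreSpace) :
    P.jonesOp g (x : P.Space) = (PreSpace.actIsometry P g x : P.PreSpace) :=
  ContinuousLinearMap.completion_apply_coe _ _

theorem jonesOp_ext {P : PythagoreanPair 𝔥} {S T : P.Space →L[ℂ] P.Space}
    (h : ∀ x : P.PreSpace, S (x : P.Space) = T (x : P.Space)) : S = T := by
  ext x
  induction x using UniformSpace.Completion.induction_on with
  | hp => exact isClosed_eq S.continuous T.continuous
  | ih x => exact h x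

theorem jonesOp_one (P : PythagoreanPair 𝔥) : P.jonesOp 1 = 1 :=
  jonesOp_ext fun x => by
    rw [jonesOp_coe, PreSpace.actIsometry_one]
    rfl

theorem jonesOp_mul (P : PythagoreanPair 𝔥) (g g' : ThompsonF) :
    P.jonesOp (g * g') = P.jonesOp g * P.jonesOp g' :=
  jonesOp_ext fun x => by
    rw [mul_apply_eq_comp, jonesOp_coe, jonesOp_coe, jonesOp_coe, PreSpace.actIsometry_mul]
    rfl

theorem inner_jonesOp (P : PythagoreanPair 𝔥) (g : ThompsonF) (x y : P.Space) :
    ⟪P.jonesOp g x, P.jonesOp g y⟫_ℂ = ⟪x, y⟫_ℂ := by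
  induction x, y using UniformSpace.Completion.induction_on₂ with
  | hp => exact isClosed_eq (by fun_prop) (by fun_prop)
  | ih x y =>
    rw [jonesOp_coe, jonesOp_coe, UniformSpace.Completion.inner_coe,
      UniformSpace.Completion.inner_coe, LinearIsometry.inner_map_map]

theorem star_jonesOp_mul (P : PythagoreanPair 𝔥) (g : ThompsonF) :
    star (P.jonesOp g) * P.jonesOp g = 1 := by
  ext x
  refine ext_inner_left ℂ fun y => ?_
  rw [mul_apply_eq_comp, ContinuousLinearMap.star_eq_adjoint,
    ContinuousLinearMap.adjoint_inner_right, inner_jonesOp]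
  rfl

theorem jonesOp_mem_unitary (P : PythagoreanPair 𝔥) (g : ThompsonF) :
    P.jonesOp g ∈ unitary (P.Space →L[ℂ] P.Space) := by
  have h := P.star_jonesOp_mul g
  have h' : P.jonesOp g * P.jonesOp g⁻¹ = 1 := by
    rw [← jonesOp_mul, mul_inv_cancel, jonesOp_one]
  refine Unitary.mem_iff.2 ⟨h, ?_⟩
  rw [left_inv_eq_right_inv h h', h']

end PythagoreanPair

/-- A unitary representation of a (discrete) group `G` on the Hilbert space `E`: a group morphism
from `G` to the unitary group of `E`. -/
abbrev UnitaryRep (G : Type*) [Group G] (E : Type*) [NormedAddCommGroup E]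
    [InnerProductSpace ℂ E] [CompleteSpace E] : Type _ :=
  G →* unitary (E →L[ℂ] E)

namespace UnitaryRep

variable {G : Type*} [Group G] {E : Type*} [NormedAddCommGroup E] [InnerProductSpace ℂ E]
  [CompleteSpace E]

/-- A subrepresentation: a topologically closed subspace that is closed under the action. -/
def IsSubrep (σ : UnitaryRep G E) (W : Submodule ℂ E) : Prop :=
  IsClosed (W : Set E) ∧ ∀ g : G, ∀ x ∈ W, (σ g : E →L[ℂ] E) x ∈ W

/-- Weakly mixing: there is no non-zero finite-dimensional subrepresentation. -/
def IsWeaklyMixing (σ : UnitaryRep G E) : Prop :=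
  ¬ ∃ W : Submodule ℂ E, IsSubrep σ W ∧ FiniteDimensional ℂ W ∧ W ≠ ⊥

end UnitaryRep

/-- The Pythagorean representation `σ : F → U(𝓗)` associated to a Pythagorean pair: the extension
to `𝓗` of the action of `F` on `𝓚` for which `σ([t, s]) [s, ξ] = [t, ξ]`. -/
noncomputable def PythagoreanPair.representation {𝔥 : Type*} [NormedAddCommGroup 𝔥]
    [InnerProductSpace ℂ 𝔥] [CompleteSpace 𝔥] (P : PythagoreanPair 𝔥) :
    UnitaryRep ThompsonF P.Space where
  toFun g := ⟨P.jonesOp g, P.jonesOp_mem_unitary g⟩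
  map_one' := Subtype.ext P.jonesOp_one
  map_mul' g g' := Subtype.ext (P.jonesOp_mul g g')

/-!
Weak mixing follows as soon as, for every finite family of vectors of a dense subspace, some group
element makes all the coefficients `⟪σ(g) x, y⟫` of the family simultaneously small: on a
finite-dimensional invariant subspace, Parseval's identity would make `σ(g)` shrink a unit vector
(`UnitaryRep.isWeaklyMixing_of_dense`).

Finitely many vectors of `𝓚` are represented by decorations of one common tree `r`. The element
`g = vineShift r n` attaches, at every leaf of `r`, the pair formed by the left and the right vine
with `n` carets, so its coefficient at `[r, ξ]`, `[r, η]` is the sum over the leaves `j` of `r` of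
the pairing of the right vine grown from `ξ j` with the left vine grown from `η j`
(`PythagoreanPair.inner_jonesOp_vineShift`).

The right vine grown from `x` reads `A x, A B x, …, A B ^ (n - 1) x, B ^ n x`, and the left vine
grown from `y` reads `A ^ n y, B A ^ (n - 1) y, …, B A y, B y`. Let `n = 2 k + 1` and cut both into
halves. By `A* A + B* B = 1` the first half of the left vine is the vine grown from `A ^ (k + 1) y`,
of total mass `‖A ^ (k + 1) y‖²`, and the second half of the right vine has mass
`‖B ^ (k + 1) x‖²`. The Cauchy–Schwarz inequality on each half bounds the pairing by
`‖x‖ ‖A ^ (k + 1) y‖ + ‖B ^ (k + 1) x‖ ‖y‖` (`PythagoreanPair.norm_rowPairing_vine_le`), which tends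
to zero.
-/

/-! ### Vines and the elements of `F` they define -/

namespace BTree

/-- The tree with `n` carets all of which lie on its rightmost branch. -/
def rightVine : ℕ → BTree
  | 0 => leaf
  | n + 1 => node leaf (rightVine n)

/-- The tree with `n` carets all of which lie on its leftmost branch. -/
def leftVine : ℕ → BTree
  | 0 => leaf
  | n + 1 => node (leftVine n) leaf

theorem numLeaves_rightVine (n : ℕ) : (rightVine n).numLeaves = n + 1 := by
  induction n with
  | zero => rfl
  | succ n ih => rw [rightVine, numLeaves, ih, numLeaves, add_comm]

theorem numLeaves_leftVine (n : ℕ) : (leftVine n).numLeaves = n + 1 := by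
  induction n with
  | zero => rfl
  | succ n ih => rw [leftVine, numLeaves, ih, numLeaves]

end BTree

namespace ThompsonF

open BTree

theorem numLeaves_graft_vine (t : BTree) (n : ℕ) :
    (graft t fun _ => leftVine n).numLeaves = (graft t fun _ => rightVine n).numLeaves := by
  simp only [numLeaves_graft, numLeaves_leftVine, numLeaves_rightVine]

/-- The element of `F` that maps, below each leaf of `t`, the right vine with `n` carets to the left
one. For `t` a leaf and `n ≥ 1` this is the `(n - 1)`-st power of the tree-diagram formed by the
vines with two carets, a standard generator of `F`. -/
def vineShift (t : BTree) (n : ℕ) : ThompsonF :=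
  mk ⟨graft t fun _ => leftVine n, graft t fun _ => rightVine n, numLeaves_graft_vine t n⟩

end ThompsonF

namespace PythagoreanPair

-- A competing source of `Inner ℂ` instances, which would keep lemmas on inner products from
-- applying.
attribute [-instance] WithCStarModule.instCStarModuleComplex

open BTree ThompsonF
open scoped InnerProductSpace

variable {𝔥 : Type*} [NormedAddCommGroup 𝔥] [InnerProductSpace ℂ 𝔥] [CompleteSpace 𝔥]

/-! ### Decorations grown on vines -/

theorem norm_sq_add_norm_sq (P : PythagoreanPair 𝔥) (x : 𝔥) :
    ‖P.A x‖ ^ 2 + ‖P.B x‖ ^ 2 = ‖x‖ ^ 2 := by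
  have h := P.inner_add_inner x x
  simp only [inner_self_eq_norm_sq_to_K] at h
  exact_mod_cast h

/-- The leaves of the right vine carry `A x, A B x, …, A B ^ (n - 1) x, B ^ n x`. -/
theorem row_rightVine (P : PythagoreanPair 𝔥) (n : ℕ) (x : 𝔥)
    (i : Fin (rightVine n).numLeaves) :
    P.row (rightVine n) x i = if (i : ℕ) < n then P.A ((P.B ^ (i : ℕ)) x) else (P.B ^ n) x := by
  induction n generalizing x with
  | zero => simp [rightVine, row]
  | succ n ih =>
    refine Fin.addCases (m := leaf.numLeaves) (n := (rightVine n).numLeaves)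
      (fun i => ?_) (fun i => ?_) i
    · refine (congrFun (leftPart_glue (P.row leaf (P.A x)) (P.row (rightVine n) (P.B x)))
        i).trans ?_
      obtain rfl : i = ⟨0, Nat.one_pos⟩ := Subsingleton.elim (α := Fin 1) _ _
      simp [row]
    · refine (congrFun (rightPart_glue (P.row leaf (P.A x)) (P.row (rightVine n) (P.B x)))
        i).trans ?_
      rw [ih]
      have hl : leaf.numLeaves = 1 := rfl
      simp only [Fin.val_natAdd, hl, add_comm 1, add_lt_add_iff_right, pow_succ]
      rfl

/-- The leaves of the left vine carry `A ^ n x, B A ^ (n - 1) x, …, B A x, B x`. -/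
theorem row_leftVine (P : PythagoreanPair 𝔥) (n : ℕ) (x : 𝔥)
    (i : Fin (leftVine n).numLeaves) :
    P.row (leftVine n) x i =
      if (i : ℕ) = 0 then (P.A ^ n) x else P.B ((P.A ^ (n - (i : ℕ))) x) := by
  induction n generalizing x with
  | zero =>
    obtain rfl : i = ⟨0, Nat.one_pos⟩ := Subsingleton.elim (α := Fin 1) _ _
    simp [leftVine, row]
  | succ n ih =>
    refine Fin.addCases (m := (leftVine n).numLeaves) (n := leaf.numLeaves)
      (fun i => ?_) (fun i => ?_) i
    · refine (congrFun (leftPart_glue (P.row (leftVine n) (P.A x)) (P.row leaf (P.B x)))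
        i).trans ?_
      have hi : (i : ℕ) ≤ n := Nat.lt_succ_iff.1 (i.2.trans_eq (numLeaves_leftVine n))
      rw [ih, Fin.val_castAdd, Nat.succ_sub hi, pow_succ, pow_succ]
      rfl
    · refine (congrFun (rightPart_glue (P.row (leftVine n) (P.A x)) (P.row leaf (P.B x)))
        i).trans ?_
      obtain rfl : i = ⟨0, Nat.one_pos⟩ := Subsingleton.elim (α := Fin 1) _ _
      simp [row, numLeaves_leftVine]

/-- Telescoping along the rightmost branch: the mass `‖x‖²` is the mass carried by the first `k`
leaves of the right vine and the mass `‖B ^ k x‖²` that remains below them. -/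
theorem sum_norm_sq_A_B_pow (P : PythagoreanPair 𝔥) (x : 𝔥) (k : ℕ) :
    ∑ i ∈ Finset.range k, ‖P.A ((P.B ^ i) x)‖ ^ 2 + ‖(P.B ^ k) x‖ ^ 2 = ‖x‖ ^ 2 := by
  induction k with
  | zero => simp
  | succ k ih =>
    rw [Finset.sum_range_succ, pow_succ' P.B, add_assoc, mul_apply_eq_comp,
      P.norm_sq_add_norm_sq, ih]

theorem sum_norm_sq_B_A_pow (P : PythagoreanPair 𝔥) (x : 𝔥) (k : ℕ) :
    ‖(P.A ^ k) x‖ ^ 2 + ∑ i ∈ Finset.range k, ‖P.B ((P.A ^ i) x)‖ ^ 2 = ‖x‖ ^ 2 := by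
  induction k with
  | zero => simp
  | succ k ih =>
    rw [Finset.sum_range_succ_comm, pow_succ' P.A, ← add_assoc, mul_apply_eq_comp,
      P.norm_sq_add_norm_sq, ih]

/-! ### Coefficients along vines -/

/-- The sum over the common leaves of `s` and `t` of the inner products of the decorations grown
from `x` and `y`: the coefficient `⟪σ([t, s]) [leaf, x], [leaf, y]⟫`. -/
noncomputable def rowPairing (P : PythagoreanPair 𝔥) {t s : BTree}
    (h : t.numLeaves = s.numLeaves) (x y : 𝔥) : ℂ :=
  ∑ i, ⟪P.row s x (Fin.cast h i), P.row t y i⟫_ℂ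

/-- The two summands are Cauchy–Schwarz bounds for the first and the last `k + 1` leaves: on the
first ones the left vine has mass `‖A ^ (k + 1) y‖²`, on the last ones the right vine has mass
`‖B ^ (k + 1) x‖²`. -/
theorem norm_rowPairing_vine_le (P : PythagoreanPair 𝔥) (k : ℕ)
    (h : (leftVine (2 * k + 1)).numLeaves = (rightVine (2 * k + 1)).numLeaves) (x y : 𝔥) :
    ‖P.rowPairing h x y‖ ≤ ‖x‖ * ‖(P.A ^ (k + 1)) y‖ + ‖(P.B ^ (k + 1)) x‖ * ‖y‖ := by
  -- The decorations of the `i`-th leaves of the right and of the left vine.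
  let u : ℕ → 𝔥 := fun i =>
    if i < 2 * k + 1 then P.A ((P.B ^ i) x) else (P.B ^ (2 * k + 1)) x
  let v : ℕ → 𝔥 := fun i =>
    if i = 0 then (P.A ^ (2 * k + 1)) y else P.B ((P.A ^ (2 * k + 1 - i)) y)
  have hu_lt (i : ℕ) (hi : i < 2 * k + 1) : u i = P.A ((P.B ^ i) x) := if_pos hi
  have hv_pos (i : ℕ) (hi : i ≠ 0) : v i = P.B ((P.A ^ (2 * k + 1 - i)) y) := if_neg hi
  have hc : P.rowPairing h x y = ∑ i ∈ Finset.range ((k + 1) + (k + 1)), ⟪u i, v i⟫_ℂ := by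
    have hn : (k + 1) + (k + 1) = (leftVine (2 * k + 1)).numLeaves := by
      rw [numLeaves_leftVine]; ring
    rw [hn, Finset.sum_range, rowPairing]
    exact Finset.sum_congr rfl fun i _ => by
      rw [P.row_rightVine, P.row_leftVine, Fin.val_cast]
  have hu₁ : ∑ i ∈ Finset.range (k + 1), ‖u i‖ ^ 2 ≤ ‖x‖ ^ 2 := by
    rw [← P.sum_norm_sq_A_B_pow x (k + 1)]
    refine le_add_of_le_of_nonneg (Finset.sum_le_sum fun i hi => ?_) (sq_nonneg _)
    rw [hu_lt i (by have := Finset.mem_range.1 hi; omega)]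
  have hv₁ : ∑ i ∈ Finset.range (k + 1), ‖v i‖ ^ 2 = ‖(P.A ^ (k + 1)) y‖ ^ 2 := by
    rw [← P.sum_norm_sq_B_A_pow _ k, Finset.sum_range_succ', add_comm,
      ← Finset.sum_range_reflect _ k]
    congr 1
    · rw [show v 0 = (P.A ^ (2 * k + 1)) y from if_pos rfl, ← mul_apply_eq_comp, ← pow_add]
      congr 4; ring
    · refine Finset.sum_congr rfl fun i hi => ?_
      have hi := Finset.mem_range.1 hi
      rw [hv_pos _ (by omega), ← mul_apply_eq_comp (P.A ^ _), ← pow_add]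
      congr 5; omega
  have hu₂ : ∑ i ∈ Finset.range (k + 1), ‖u (k + 1 + i)‖ ^ 2 = ‖(P.B ^ (k + 1)) x‖ ^ 2 := by
    rw [← P.sum_norm_sq_A_B_pow _ k, Finset.sum_range_succ]
    congr 1
    · refine Finset.sum_congr rfl fun i hi => ?_
      have hi := Finset.mem_range.1 hi
      rw [hu_lt _ (by omega), ← mul_apply_eq_comp (P.B ^ _), ← pow_add, add_comm i]
    · rw [show u (k + 1 + k) = (P.B ^ (2 * k + 1)) x from if_neg (by omega),
        ← mul_apply_eq_comp, ← pow_add]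
      congr 4; ring
  have hv₂ : ∑ i ∈ Finset.range (k + 1), ‖v (k + 1 + i)‖ ^ 2 ≤ ‖y‖ ^ 2 := by
    rw [← P.sum_norm_sq_B_A_pow y (k + 1), ← Finset.sum_range_reflect _ (k + 1)]
    refine le_add_of_nonneg_of_le (sq_nonneg _) (Finset.sum_le_sum fun i hi => le_of_eq ?_)
    have hi := Finset.mem_range.1 hi
    rw [hv_pos _ (by omega)]
    congr 5; omega
  have key (f g : ℕ → 𝔥) (a b : ℝ) (ha : 0 ≤ a) (hb : 0 ≤ b)
      (hf : ∑ i ∈ Finset.range (k + 1), ‖f i‖ ^ 2 ≤ a ^ 2)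
      (hg : ∑ i ∈ Finset.range (k + 1), ‖g i‖ ^ 2 ≤ b ^ 2) :
      ‖∑ i ∈ Finset.range (k + 1), ⟪f i, g i⟫_ℂ‖ ≤ a * b := calc
    _ ≤ ∑ i ∈ Finset.range (k + 1), ‖f i‖ * ‖g i‖ :=
      norm_sum_le_of_le _ fun i _ => norm_inner_le_norm _ _
    _ ≤ √(∑ i ∈ Finset.range (k + 1), ‖f i‖ ^ 2) * √(∑ i ∈ Finset.range (k + 1), ‖g i‖ ^ 2) :=
      Real.sum_mul_le_sqrt_mul_sqrt _ _ _
    _ ≤ a * b := mul_le_mul (Real.sqrt_le_iff.2 ⟨ha, hf⟩) (Real.sqrt_le_iff.2 ⟨hb, hg⟩)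
      (Real.sqrt_nonneg _) ha
  rw [hc, Finset.sum_range_add]
  exact (norm_add_le _ _).trans (add_le_add
    (key _ _ _ _ (norm_nonneg _) (norm_nonneg _) hu₁ hv₁.le)
    (key _ _ _ _ (norm_nonneg _) (norm_nonneg _) hu₂.le hv₂))

theorem tendsto_rowPairing_vine (P : PythagoreanPair 𝔥)
    (hA : ∀ ξ : 𝔥, Tendsto (fun n : ℕ => (P.A ^ n) ξ) atTop (𝓝 0))
    (hB : ∀ ξ : 𝔥, Tendsto (fun n : ℕ => (P.B ^ n) ξ) atTop (𝓝 0))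
    (h : ∀ n, (leftVine n).numLeaves = (rightVine n).numLeaves) (x y : 𝔥) :
    Tendsto (fun k => P.rowPairing (h (2 * k + 1)) x y) atTop (𝓝 0) := by
  refine squeeze_zero_norm (fun k => P.norm_rowPairing_vine_le k (h _) x y) ?_
  have h1 := ((tendsto_add_atTop_iff_nat 1).2 (hA y)).norm.const_mul ‖x‖
  have h2 := ((tendsto_add_atTop_iff_nat 1).2 (hB x)).norm.mul_const ‖y‖
  simpa using h1.add h2

/-- When the same tree `t`, respectively `s`, is attached at every leaf of `r`, the pairing of the
grown decorations is the sum over the leaves of `r` of the pairings of `t` with `s`. -/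
theorem sum_inner_grow_graft_const (P : PythagoreanPair 𝔥) {t s : BTree}
    (h : t.numLeaves = s.numLeaves) (r : BTree)
    (h' : (graft r fun _ => t).numLeaves = (graft r fun _ => s).numLeaves)
    (ξ η : Fin r.numLeaves → 𝔥) :
    ∑ i, ⟪P.grow r (graft r fun _ => s) ξ (Fin.cast h' i), P.grow r (graft r fun _ => t) η i⟫_ℂ =
      ∑ j, P.rowPairing h (ξ j) (η j) := by
  induction r with
  | leaf => exact (Fin.sum_univ_one fun i : Fin 1 => P.rowPairing h (ξ i) (η i)).symm
  | node a b ha hb =>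
    have hab (c : BTree) : (graft c fun _ => t).numLeaves = (graft c fun _ => s).numLeaves := by
      simp only [numLeaves_graft, h]
    rw [sum_node fun j => P.rowPairing h (ξ j) (η j)]
    refine Eq.trans ?_ (congrArg₂ (· + ·) (ha (hab a) (leftPart ξ) (leftPart η))
      (hb (hab b) (rightPart ξ) (rightPart η)))
    refine (sum_node (l := graft a fun _ => t) (r := graft b fun _ => t) _).trans
      (congrArg₂ (· + ·) (Finset.sum_congr rfl fun i _ => ?_)
        (Finset.sum_congr rfl fun i _ => ?_))
    · refine congrArg₂ _ ?_ (congrFun (leftPart_glue _ _) i)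
      refine Eq.trans (congrArg _ ?_) (congrFun (leftPart_glue _
        (P.grow b (graft b fun _ => s) (rightPart ξ))) (Fin.cast (hab a) i))
      exact Fin.ext rfl
    · refine congrArg₂ _ ?_ (congrFun (rightPart_glue _ _) i)
      refine Eq.trans (congrArg _ ?_) (congrFun (rightPart_glue
        (P.grow a (graft a fun _ => s) (leftPart ξ)) _) (Fin.cast (hab b) i))
      exact Fin.ext (congrArg (· + (i : ℕ)) (hab a))

/-- The coefficients of `vineShift r n` at vectors represented on `r` itself. -/
theorem inner_jonesOp_vineShift (P : PythagoreanPair 𝔥) (r : BTree) (n : ℕ)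
    (h : (leftVine n).numLeaves = (rightVine n).numLeaves) (ξ η : TreeSpace 𝔥 r) :
    ⟪P.jonesOp (vineShift r n) (PreSpace.mk P r ξ : P.Space), (PreSpace.mk P r η : P.Space)⟫_ℂ =
      ∑ j, P.rowPairing h (ξ j) (η j) := by
  rw [jonesOp_coe, UniformSpace.Completion.inner_coe,
    ← PreSpace.mk_connect (le_graft r fun _ => rightVine n) ξ,
    ← PreSpace.mk_connect (le_graft r fun _ => leftVine n) η, PreSpace.actIsometry_apply,
    vineShift, PreSpace.smulF_mk, PreSpace.inner_mk_mk, PiLp.inner_apply]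
  exact P.sum_inner_grow_graft_const h r (numLeaves_graft_vine r n) ξ.ofLp η.ofLp

end PythagoreanPair

/-! ### A criterion for weak mixing -/

namespace UnitaryRep

open scoped InnerProductSpace

variable {G : Type*} [Group G] {E : Type*} [NormedAddCommGroup E] [InnerProductSpace ℂ E]
  [CompleteSpace E]

theorem norm_apply (σ : UnitaryRep G E) (g : G) (x : E) : ‖(σ g : E →L[ℂ] E) x‖ = ‖x‖ :=
  Unitary.norm_map (σ g) x

/-- It suffices to make the coefficients of finite families of vectors of a dense subset
simultaneously small: on a finite-dimensional invariant subspace `W`, `σ g` then has small matrix entries in an orthonormal basis, although it is isometric. -/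
theorem isWeaklyMixing_of_dense (σ : UnitaryRep G E) {D : Set E} (hD : Dense D)
    (H : ∀ (d : ℕ) (x : Fin d → E), (∀ i, x i ∈ D) → ∀ ε > 0,
      ∃ g, ∀ i j, ‖⟪(σ g : E →L[ℂ] E) (x i), x j⟫_ℂ‖ < ε) :
    σ.IsWeaklyMixing := by
  rintro ⟨W, ⟨-, hW⟩, hfin, hne⟩
  set d := Module.finrank ℂ W
  have hd : 0 < d := Module.finrank_pos_iff.2 (Submodule.nontrivial_iff_ne_bot.2 hne)
  let e : OrthonormalBasis (Fin d) ℂ W := stdOrthonormalBasis ℂ W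
  -- A row of `d` entries of size at most `4 δ = 1 / (d + 1)` has norm less than `1`.
  set δ : ℝ := 1 / (4 * (d + 1)) with hδ
  have hδ0 : 0 < δ := by positivity
  have hδ1 : δ ≤ 1 := by
    rw [hδ, div_le_one (by positivity)]
    nlinarith [Nat.cast_nonneg (α := ℝ) d]
  choose x hxD hx using fun i => hD.exists_dist_lt (e i : E) hδ0
  obtain ⟨g, hg⟩ := H d x hxD δ hδ0
  have he (i : Fin d) : ‖(e i : E)‖ = 1 := e.norm_eq_one i
  have hx' (i : Fin d) : ‖(e i : E) - x i‖ ≤ δ := by rw [← dist_eq_norm]; exact (hx i).le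
  have hxn (i : Fin d) : ‖x i‖ ≤ 2 := by
    have := norm_sub_le (e i : E) ((e i : E) - x i)
    rw [sub_sub_cancel, he] at this
    linarith [hx' i]
  -- The basis vectors of `W` inherit small coefficients from their approximations.
  have hsmall (i j : Fin d) : ‖⟪(σ g : E →L[ℂ] E) (e i), (e j : E)⟫_ℂ‖ ≤ 4 * δ := by
    have hsplit : ⟪(σ g : E →L[ℂ] E) (e i), (e j : E)⟫_ℂ =
        ⟪(σ g : E →L[ℂ] E) (e i), (e j : E) - x j⟫_ℂ +
        ⟪(σ g : E →L[ℂ] E) ((e i : E) - x i), x j⟫_ℂ +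
        ⟪(σ g : E →L[ℂ] E) (x i), x j⟫_ℂ := by
      simp only [map_sub, inner_sub_left, inner_sub_right]
      ring
    rw [hsplit]
    refine (norm_add₃_le).trans ?_
    have h1 := norm_inner_le_norm (𝕜 := ℂ) ((σ g : E →L[ℂ] E) (e i)) ((e j : E) - x j)
    have h2 := norm_inner_le_norm (𝕜 := ℂ) ((σ g : E →L[ℂ] E) ((e i : E) - x i)) (x j)
    rw [norm_apply, he, one_mul] at h1
    rw [norm_apply] at h2
    nlinarith [hx' i, hx' j, hxn j, hg i j, norm_nonneg (x j), norm_nonneg ((e i : E) - x i)]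
  -- But `σ g` preserves the norm of `e i`, and Parseval's identity in `W` computes the norm of
  -- its image from the coefficients.
  let i : Fin d := ⟨0, hd⟩
  let w : W := ⟨(σ g : E →L[ℂ] E) (e i), hW g _ (e i).2⟩
  have hw : ‖w‖ = 1 := (norm_apply σ g _).trans (he i)
  have hsum := e.sum_sq_norm_inner_left w
  rw [hw] at hsum
  have hle : ∑ j, ‖⟪w, e j⟫_ℂ‖ ^ 2 ≤ ∑ _j : Fin d, (4 * δ) ^ 2 :=
    Finset.sum_le_sum fun j _ => pow_le_pow_left₀ (norm_nonneg _) (hsmall i j) 2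
  have h4 : 4 * δ = 1 / (d + 1) := by rw [hδ]; field_simp
  rw [hsum, Finset.sum_const, Finset.card_univ, Fintype.card_fin, nsmul_eq_mul, h4, div_pow,
    one_pow, mul_one_div, le_div_iff₀ (by positivity)] at hle
  nlinarith [Nat.cast_nonneg (α := ℝ) d]

end UnitaryRep

/-! ### Weak mixing of the Pythagorean representation -/

theorem corollaryC {𝔥 : Type*} [NormedAddCommGroup 𝔥] [InnerProductSpace ℂ 𝔥] [CompleteSpace 𝔥]
    (P : PythagoreanPair 𝔥)
    (hA : ∀ ξ : 𝔥, Tendsto (fun n : ℕ => (P.A ^ n) ξ) atTop (𝓝 0))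
    (hB : ∀ ξ : 𝔥, Tendsto (fun n : ℕ => (P.B ^ n) ξ) atTop (𝓝 0)) :
    P.representation.IsWeaklyMixing := by
  refine UnitaryRep.isWeaklyMixing_of_dense _ UniformSpace.Completion.denseRange_coe
    fun d x hx ε hε => ?_
  choose y hy using hx
  choose t ζ _ hζ using fun i => PythagoreanPair.PreSpace.exists_mk (y i) .leaf
  -- All the vectors of the family are represented by decorations of one common tree `r`.
  obtain ⟨r, hr⟩ := Finite.exists_le t
  have hξ (i : Fin d) : (PythagoreanPair.PreSpace.mk P r (P.connect _ r (hr i) (ζ i)) :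
      P.Space) = x i := by
    rw [PythagoreanPair.PreSpace.mk_connect, ← hζ, hy]
  have hn (n : ℕ) : (BTree.leftVine n).numLeaves = (BTree.rightVine n).numLeaves := by
    rw [BTree.numLeaves_leftVine, BTree.numLeaves_rightVine]
  have hlim (i j : Fin d) := (tendsto_finsetSum Finset.univ fun l _ =>
    P.tendsto_rowPairing_vine hA hB hn (P.connect _ r (hr i) (ζ i) l)
      (P.connect _ r (hr j) (ζ j) l)).norm
  simp only [Finset.sum_const_zero, norm_zero] at hlim
  obtain ⟨k, hk⟩ := (eventually_all.2 fun i => eventually_all.2 fun j =>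
    (hlim i j).eventually_lt_const hε).exists
  refine ⟨ThompsonF.vineShift r (2 * k + 1), fun i j => ?_⟩
  rw [← hξ i, ← hξ j]
  exact (congrArg norm (P.inner_jonesOp_vineShift r _ (hn _) _ _)).trans_lt (hk i j)
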